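/- Let $H$ be a complex Hilbert space, $n\ge 1$ an integer, and $T$ a bounded linear operator on $H$ that is an $n$-hypercontraction, i.e. $\sum_{j=0}^{k}(-1)^j\binom{k}{j}T^{*j}T^{j}\ge 0$ for every $1\le k\le n$. Let $\mathcal M\subsetneq H$ be a proper closed subspace with $T\mathcal M\subseteq\mathcal M$ such that the restriction $A:=T|_{\mathcal M}\colon\mathcal M\to\mathcal M$ belongs to the Cowen--Douglas class $B_1(\mathbb D)$ of the open unit disk $\mathbb D$: for every $\omega\in\mathbb D$ the operator $A-\omega$ is surjective with $\dim\ker(A-\omega)=1$, and the closed linear span of $\bigcup_{\omega\in\mathbb D}\ker(A-\omega)$ is $\mathcal M$. Suppose that there is a vector $e\in\mathcal M$ with $\|e\|=1$ and $$\sum_{i=0}^{n}(-1)^i\binom{n}{i}A^{*i}A^{i}=e\otimes e,$$ where $(e\otimes e)x=\langle x,e\rangle e$ for $x\in\mathcal M$ and $A^*$ is the adjoint of $A$ on $\mathcal M$. Then $T$ is reducible, i.e. there is a closed subspace $\mathcal N$ of $H$, $\{0\}\ne\mathcal N\ne H$, such that $\mathcal N$ and $\mathcal N^\perp$ are both invariant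 under $T$. -/

import Mathlib

namespace OperatorReducibility

/-- The `k`-th defect operator `∑_{j=0}^{k} (-1)^j C(k,j) (T^*)^j T^j`. -/
noncomputable def defect {H : Type*} [NormedAddCommGroup H] [InnerProductSpace ℂ H]
    [CompleteSpace H] (T : H →L[ℂ] H) (k : ℕ) : H →L[ℂ] H :=
  ∑ j ∈ Finset.range (k + 1),
    ((-1 : ℂ) ^ j * (k.choose j : ℂ)) • ((ContinuousLinearMap.adjoint T) ^ j * T ^ j)

/-- `T` is an `n`-hypercontraction: its `k`-th defect operator is positive for `1 ≤ k ≤ n`. -/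
def IsHypercontraction {H : Type*} [NormedAddCommGroup H] [InnerProductSpace ℂ H]
    [CompleteSpace H] (n : ℕ) (T : H →L[ℂ] H) : Prop :=
  ∀ k : ℕ, 1 ≤ k → k ≤ n → (defect T k).IsPositive

/-- `Lat T`: the closed linear subspaces `M` with `T M ⊆ M`. -/
def Lat {H : Type*} [NormedAddCommGroup H] [InnerProductSpace ℂ H]
    (T : H →L[ℂ] H) : Set (ClosedSubmodule ℂ H) :=
  {M | ∀ x ∈ M, T x ∈ M}

instance instCompleteSpaceToSubmodule {H : Type*} [NormedAddCommGroup H] [InnerProductSpace ℂ H]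
    [CompleteSpace H] (M : ClosedSubmodule ℂ H) : CompleteSpace M.toSubmodule :=
  M.isClosed'.isComplete.completeSpace_coe

/-- The restriction `T|_M : M → M` of `T` to an invariant subspace `M`. -/
def restrictTo {H : Type*} [NormedAddCommGroup H] [InnerProductSpace ℂ H]
    (T : H →L[ℂ] H) (M : ClosedSubmodule ℂ H) (hM : M ∈ Lat T) :
    M.toSubmodule →L[ℂ] M.toSubmodule :=
  T.restrict (p := M.toSubmodule) (q := M.toSubmodule) hM

/-- `T ∈ B_n(Ω)`, the Cowen–Douglas class of index `n` over a (bounded open) set `Ω ⊆ ℂ`. -/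
structure IsCowenDouglas {H : Type*} [NormedAddCommGroup H] [InnerProductSpace ℂ H]
    (T : H →L[ℂ] H) (n : ℕ) (Ω : Set ℂ) : Prop where
  surjective : ∀ w ∈ Ω, Function.Surjective (T - w • ContinuousLinearMap.id ℂ H)
  rank_ker : ∀ w ∈ Ω,
    Module.rank ℂ (LinearMap.ker (T - w • ContinuousLinearMap.id ℂ H).toLinearMap) = n
  span_ker : (⨆ w ∈ Ω,
    LinearMap.ker (T - w • ContinuousLinearMap.id ℂ H).toLinearMap).topologicalClosure = ⊤

/-- `T` is reducible: some closed subspace `N`, different from `0` and from the whole space, is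
such that both `N` and its orthogonal complement are invariant under `T`. -/
def IsReducible {H : Type*} [NormedAddCommGroup H] [InnerProductSpace ℂ H]
    (T : H →L[ℂ] H) : Prop :=
  ∃ N : ClosedSubmodule ℂ H, N ≠ ⊥ ∧ N ≠ ⊤ ∧
    (∀ x ∈ N, T x ∈ N) ∧ (∀ x ∈ N.toSubmoduleᗮ, T x ∈ N.toSubmoduleᗮ)

end OperatorReducibility

namespace OperatorReducibility

open Filter Topology

/-! The space `M` itself reduces `T`. For `x` in `H` and `y` in `M`, the sequence `a j = ⟨T^j x, T^j
y⟩` tends to zero, since `T` is a contraction and the powers of `A = T|_M` tend to zero strongly.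
Hence its `n`-th difference, `(-1)^n ⟨T^j x, D T^j y⟩` with `D = defect T n`, determines it.
Positivity of `D` upgrades the compression identity `e ⊗ e` to `D y = ⟨e, y⟩ D e` on `M`
(`defect_apply_coe_eq_smul`), so the difference is `(-1)^n ⟨e, A^j y⟩ ⟨T^j x, D e⟩`. Let `x ⟂ M`.
Choosing `y` with `⟨e, A^j y⟩ = δ_{jk}` makes `a 0 = 0` a positive multiple of `⟨T^k x, D e⟩`, which
therefore vanishes for every `k`. Then all differences for `T x` vanish, and so does `⟨T x, y⟩` for
every `y` in `M`. -/

/-- A null sequence whose `n`-th difference is concentrated at `k` is a multiple of its value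
there; for `n ≥ 1` the factors up to `k` do not vanish. -/
theorem exists_pos_of_fwdDiff_iter_eq_single (n k : ℕ) (c : ℂ) (a : ℕ → ℂ)
    (ha : Tendsto a atTop (𝓝 0)) (h : ∀ j, (fwdDiff 1)^[n] a j = if j = k then c else 0) :
    ∃ r : ℕ → ℝ, (∀ j, 0 ≤ r j) ∧ (∀ j, k < j → r j = 0) ∧
      (∀ j ≤ k, (n = 0 → j = k) → 0 < r j) ∧ ∀ j, a j = r j * ((-1) ^ n * c) := by
  induction n generalizing a with
  | zero =>
    refine ⟨fun j => if j = k then 1 else 0, fun j => by positivity,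
      fun j hj => by simp [hj.ne'], fun j _ hj => by simp [hj rfl], fun j => ?_⟩
    have := h j
    simp only [Function.iterate_zero, id] at this
    rw [this]
    by_cases hj : j = k <;> simp [hj]
  | succ n ih =>
    have hd : Tendsto (fwdDiff 1 a) atTop (𝓝 0) := by
      rw [← sub_zero (0 : ℂ)]
      exact ((tendsto_add_atTop_iff_nat 1).2 ha).sub ha
    obtain ⟨r, hnn, hr0, hr, hra⟩ := ih (fwdDiff 1 a) hd h
    have hstep : ∀ j, a j = a (j + 1) + r j * ((-1) ^ (n + 1) * c) := fun j => by
      have := hra j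
      simp only [fwdDiff] at this
      rw [pow_succ]
      linear_combination -this
    have htail : ∀ j, k < j → a j = 0 := fun j hj => by
      have hconst : ∀ m, a (m + j) = a j := fun m => by
        induction m with
        | zero => simp
        | succ m hm =>
          rw [← hm, hstep (m + j), hr0 (m + j) (by omega)]
          simp [Nat.add_right_comm]
      refine tendsto_nhds_unique ?_ ((tendsto_add_atTop_iff_nat j).2 ha)
      simp [hconst]
    -- A null sequence is minus the sum of its later differences, and those beyond `k` vanish.
    refine ⟨fun j => ∑ i ∈ Finset.Ico j (k + 1), r i, fun j => Finset.sum_nonneg fun i _ => hnn i,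
      fun j hj => by simp [Finset.Ico_eq_empty_of_le (Nat.succ_le_of_lt hj)], fun j hj _ => ?_,
      fun j => ?_⟩
    · exact Finset.sum_pos' (fun i _ => hnn i)
        ⟨k, Finset.mem_Ico.2 ⟨hj, k.lt_succ_self⟩, hr k le_rfl fun _ => rfl⟩
    · rcases lt_or_ge k j with hj | hj
      · simp [htail j hj, Finset.Ico_eq_empty_of_le (Nat.succ_le_of_lt hj)]
      · induction hj using Nat.decreasingInduction with
        | self => rw [hstep, htail (k + 1) k.lt_succ_self]; simp
        | of_succ j hj hj' =>
          rw [hstep, hj']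
          beta_reduce
          rw [Finset.sum_eq_sum_Ico_succ_bot (show j < k + 1 by omega)]
          push_cast
          ring

section Defect

variable {H : Type*} [NormedAddCommGroup H] [InnerProductSpace ℂ H] [CompleteSpace H]

theorem inner_adjoint_pow_mul_pow (T : H →L[ℂ] H) (j : ℕ) (x y : H) :
    inner ℂ x ((ContinuousLinearMap.adjoint T ^ j * T ^ j) y) =
      inner ℂ ((T ^ j) x) ((T ^ j) y) := by
  have : ContinuousLinearMap.adjoint T ^ j = ContinuousLinearMap.adjoint (T ^ j) := by
    simp only [← ContinuousLinearMap.star_eq_adjoint, star_pow]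
  rw [this, mul_apply_eq_comp, ContinuousLinearMap.adjoint_inner_right]

theorem inner_defect (T : H →L[ℂ] H) (n : ℕ) (x y : H) :
    inner ℂ x (defect T n y) = ∑ j ∈ Finset.range (n + 1),
      ((-1 : ℂ) ^ j * (n.choose j : ℂ)) * inner ℂ ((T ^ j) x) ((T ^ j) y) := by
  simp only [defect, sum_apply, inner_sum, smul_apply,
    inner_smul_right, inner_adjoint_pow_mul_pow]

theorem fwdDiff_iter_inner_pow (T : H →L[ℂ] H) (n : ℕ) (x y : H) (j : ℕ) :
    (fwdDiff 1)^[n] (fun i => inner ℂ ((T ^ i) x) ((T ^ i) y)) j =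
      (-1 : ℂ) ^ n * inner ℂ ((T ^ j) x) (defect T n ((T ^ j) y)) := by
  rw [fwdDiff_iter_eq_sum_shift, inner_defect, Finset.mul_sum]
  refine Finset.sum_congr rfl fun i hi => ?_
  obtain ⟨m, rfl⟩ := Nat.exists_eq_add_of_le (Nat.lt_succ_iff.1 (Finset.mem_range.1 hi))
  have hsq : ((-1 : ℂ) ^ i) * (-1) ^ i = 1 := by rw [← mul_pow]; simp
  have hpow : ∀ z, (T ^ i) ((T ^ j) z) = (T ^ (j + i)) z := fun z => by
    rw [add_comm, pow_add, mul_apply_eq_comp]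
  simp only [hpow, zsmul_eq_mul, smul_eq_mul, mul_one,
    Nat.add_sub_cancel_left, Int.cast_mul, Int.cast_pow, Int.cast_neg, Int.cast_one,
    Int.cast_natCast]
  rw [pow_add (-1 : ℂ) i m]
  linear_combination (-((-1 : ℂ) ^ m) * (i + m).choose i *
    inner ℂ ((T ^ (j + i)) x) ((T ^ (j + i)) y)) * hsq

theorem norm_apply_le_of_isPositive_defect_one {T : H →L[ℂ] H} (hT : (defect T 1).IsPositive)
    (x : H) : ‖T x‖ ≤ ‖x‖ := by
  have h := hT.re_inner_nonneg_right x
  rw [inner_defect] at h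
  simp only [Finset.sum_range_succ, Finset.sum_range_zero] at h
  simp [inner_self_eq_norm_sq_to_K] at h
  norm_cast at h
  exact (sq_le_sq₀ (norm_nonneg _) (norm_nonneg _)).1 (by simpa using h)

omit [CompleteSpace H] in
theorem norm_pow_apply_le {T : H →L[ℂ] H} (hT : ∀ x, ‖T x‖ ≤ ‖x‖) (j : ℕ) (x : H) :
    ‖(T ^ j) x‖ ≤ ‖x‖ := by
  induction j with
  | zero => simp
  | succ j ih => rw [pow_succ']; exact (hT _).trans ih

omit [CompleteSpace H] in
/-- The vectors whose orbit under a contraction tends to zero form a closed set. -/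
theorem isClosed_setOf_tendsto_pow {T : H →L[ℂ] H} (hT : ∀ x, ‖T x‖ ≤ ‖x‖) :
    IsClosed {x | Tendsto (fun j => (T ^ j) x) atTop (𝓝 0)} := by
  refine isClosed_of_closure_subset fun x hx => ?_
  rw [Set.mem_ofPred_eq, Metric.tendsto_atTop]
  intro ε hε
  obtain ⟨y, hy, hxy⟩ := Metric.mem_closure_iff.1 hx (ε / 2) (by positivity)
  obtain ⟨N, hN⟩ := Metric.tendsto_atTop.1 hy (ε / 2) (by positivity)
  refine ⟨N, fun j hj => ?_⟩
  have h1 := norm_pow_apply_le hT j (x - y)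
  have h2 := hN j hj
  rw [dist_eq_norm] at hxy
  rw [dist_zero_right] at h2 ⊢
  calc ‖(T ^ j) x‖ = ‖(T ^ j) (x - y) + (T ^ j) y‖ := by simp
    _ ≤ ‖(T ^ j) (x - y)‖ + ‖(T ^ j) y‖ := norm_add_le _ _
    _ < ε := by linarith

omit [CompleteSpace H] in
theorem IsCowenDouglas.tendsto_pow {A : H →L[ℂ] H} {n : ℕ}
    (hA : IsCowenDouglas A n (Metric.ball 0 1)) (hT : ∀ x, ‖A x‖ ≤ ‖x‖) (x : H) :
    Tendsto (fun j => (A ^ j) x) atTop (𝓝 0) := by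
  let S : Submodule ℂ H :=
    { carrier := {x | Tendsto (fun j => (A ^ j) x) atTop (𝓝 0)}
      add_mem' := fun {a b} ha hb => by
        simp only [Set.mem_ofPred_eq, map_add] at *
        simpa using ha.add hb
      zero_mem' := by simp
      smul_mem' := fun c a ha => by
        simp only [Set.mem_ofPred_eq, map_smul] at *
        simpa using ha.const_smul c }
  have hle : (⨆ w ∈ Metric.ball (0 : ℂ) 1,
      LinearMap.ker (A - w • ContinuousLinearMap.id ℂ H).toLinearMap) ≤ S := by
    refine iSup₂_le fun w hw v hv => ?_
    have hv' : A v = w • v := by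
      simpa [sub_eq_zero] using hv
    have hpow : ∀ j, (A ^ j) v = w ^ j • v := fun j => by
      induction j with
      | zero => simp
      | succ j ih => rw [pow_succ', mul_apply_eq_comp, ih, map_smul, hv', smul_smul,
          pow_succ]
    change Tendsto (fun j => (A ^ j) v) atTop (𝓝 0)
    simp only [hpow]
    rw [← zero_smul ℂ v]
    exact (tendsto_pow_atTop_nhds_zero_of_norm_lt_one (by simpa using hw)).smul_const v
  have htop := Submodule.topologicalClosure_minimal _ hle (isClosed_setOf_tendsto_pow hT)
  rw [hA.span_ker] at htop
  exact htop (Submodule.mem_top (x := x))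

theorem defect_apply_of_apply_eq_zero {A : H →L[ℂ] H} {x : H} (hx : A x = 0) (n : ℕ) :
    defect A n x = x := by
  rw [defect, sum_apply, Finset.sum_eq_single_of_mem 0 (by simp)]
  · simp
  · intro j _ hj
    obtain ⟨i, rfl⟩ := Nat.exists_eq_succ_of_ne_zero hj
    simp [pow_succ, hx]

/-- If the defect of a Cowen–Douglas operator is `e ⊗ e`, then `e` is in the kernel. -/
theorem IsCowenDouglas.apply_eq_zero_of_defect_eq {A : H →L[ℂ] H} {Ω : Set ℂ} {n : ℕ} {e : H}
    (hA : IsCowenDouglas A 1 Ω) (h0 : (0 : ℂ) ∈ Ω)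
    (hdefect : defect A n = InnerProductSpace.rankOne ℂ e e) : A e = 0 := by
  have hr := hA.rank_ker 0 h0
  have : Nontrivial (LinearMap.ker (A - (0 : ℂ) • ContinuousLinearMap.id ℂ H).toLinearMap) :=
    rank_pos_iff_nontrivial.1 (by rw [hr]; simp)
  obtain ⟨⟨y, hy⟩, hy0⟩ := exists_ne
    (0 : LinearMap.ker (A - (0 : ℂ) • ContinuousLinearMap.id ℂ H).toLinearMap)
  have hAy : A y = 0 := by simpa using hy
  -- The defect fixes kernel vectors, as only its zeroth term survives there; so `y` lies in the
  -- range of `e ⊗ e`.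
  have hye : y = inner ℂ e y • e := by
    conv_lhs => rw [← defect_apply_of_apply_eq_zero hAy n, hdefect]
    simp
  have hne : inner ℂ e y ≠ 0 := fun h => hy0 (by
    rw [h, zero_smul] at hye
    exact Subtype.ext hye)
  have := congrArg A hye
  rw [hAy, map_smul, eq_comm, smul_eq_zero] at this
  exact this.resolve_left hne

-- Lift `e` through `A` repeatedly, each time removing the `e`-component. Since `A e = 0`, this
-- correction affects only the entry `j = 0`.
omit [CompleteSpace H] in
theorem exists_inner_pow_eq_single {A : H →L[ℂ] H} (hA : Function.Surjective A) {e : H}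
    (he : ‖e‖ = 1) (hAe : A e = 0) (k : ℕ) :
    ∃ y, ∀ j, inner ℂ e ((A ^ j) y) = if j = k then (1 : ℂ) else 0 := by
  have hee : inner ℂ e e = (1 : ℂ) := by simp [inner_self_eq_norm_sq_to_K, he]
  induction k with
  | zero =>
    refine ⟨e, fun j => ?_⟩
    cases j with
    | zero => simpa using hee
    | succ j => simp [pow_succ, hAe]
  | succ k ih =>
    obtain ⟨y, hy⟩ := ih
    obtain ⟨z, rfl⟩ := hA y
    refine ⟨z - inner ℂ e z • e, fun j => ?_⟩
    cases j with
    | zero => simp [he]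
    | succ j => simpa [pow_succ, hAe] using hy j

/-- A vector at which the form of a positive operator vanishes is in the kernel. -/
theorem apply_eq_zero_of_isPositive {D : H →L[ℂ] H} (hD : D.IsPositive) {x : H}
    (hx : inner ℂ x (D x) = 0) : D x = 0 := by
  obtain ⟨S, rfl⟩ := CStarAlgebra.nonneg_iff_eq_star_mul_self.1
    ((ContinuousLinearMap.nonneg_iff_isPositive D).2 hD)
  rw [mul_apply_eq_comp, ContinuousLinearMap.star_eq_adjoint] at hx ⊢
  rw [ContinuousLinearMap.adjoint_inner_right, inner_self_eq_zero] at hx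
  rw [hx, map_zero]

omit [CompleteSpace H] in
theorem coe_restrictTo_pow (T : H →L[ℂ] H) (M : ClosedSubmodule ℂ H) (hM : M ∈ Lat T) (j : ℕ)
    (x : M.toSubmodule) : ((restrictTo T M hM ^ j) x : H) = (T ^ j) (x : H) := by
  induction j with
  | zero => simp
  | succ j ih =>
    rw [pow_succ', pow_succ', mul_apply_eq_comp, mul_apply_eq_comp, ← ih]
    rfl

theorem inner_defect_restrictTo (T : H →L[ℂ] H) (M : ClosedSubmodule ℂ H) (hM : M ∈ Lat T)
    (n : ℕ) (x y : M.toSubmodule) :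
    inner ℂ x (defect (restrictTo T M hM) n y) = inner ℂ (x : H) (defect T n y) := by
  rw [inner_defect, inner_defect]
  simp only [Submodule.coe_inner, coe_restrictTo_pow]

/-- If a positive defect operator compresses to `e ⊗ e` on `M`, its restriction to `M` has rank
one. -/
theorem defect_apply_coe_eq_smul {T : H →L[ℂ] H} {n : ℕ} (hT : (defect T n).IsPositive)
    {M : ClosedSubmodule ℂ H} (hM : M ∈ Lat T) {e : M.toSubmodule} (he : ‖e‖ = 1)
    (hdefect : defect (restrictTo T M hM) n = InnerProductSpace.rankOne ℂ e e)
    (y : M.toSubmodule) : defect T n (y : H) = inner ℂ e y • defect T n (e : H) := by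
  have h : defect T n ((y - inner ℂ e y • e : M.toSubmodule) : H) = 0 := by
    -- The form of the defect at a vector of `M` orthogonal to `e` is that of `e ⊗ e`, hence zero.
    refine apply_eq_zero_of_isPositive hT ?_
    rw [← inner_defect_restrictTo T M hM, hdefect]
    simp [inner_sub_right, inner_smul_right, he, -Submodule.coe_inner]
  rw [Submodule.coe_sub, Submodule.coe_smul, map_sub, map_smul, sub_eq_zero] at h
  exact h

end Defect

end OperatorReducibility

open OperatorReducibility Filter Topology in
theorem mainTheorem7 {H : Type*} [NormedAddCommGroup H] [InnerProductSpace ℂ H] [CompleteSpace H]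
    (n : ℕ) (hn : 1 ≤ n) (T : H →L[ℂ] H) (hT : OperatorReducibility.IsHypercontraction n T)
    (M : ClosedSubmodule ℂ H) (hM : M ∈ OperatorReducibility.Lat T) (hM_proper : M ≠ ⊤)
    (hCD : OperatorReducibility.IsCowenDouglas (OperatorReducibility.restrictTo T M hM) 1
      (Metric.ball (0 : ℂ) 1))
    (e : M.toSubmodule) (he : ‖e‖ = 1)
    (hdefect : OperatorReducibility.defect (OperatorReducibility.restrictTo T M hM) n =
      InnerProductSpace.rankOne ℂ e e) :
    OperatorReducibility.IsReducible T := by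
  have hcontr := norm_apply_le_of_isPositive_defect_one (hT 1 le_rfl hn)
  have h0 : (0 : ℂ) ∈ Metric.ball (0 : ℂ) 1 := by simp
  have hAe := hCD.apply_eq_zero_of_defect_eq h0 hdefect
  have hsurj : Function.Surjective (restrictTo T M hM) := by simpa using hCD.surjective 0 h0
  have htend (x : H) (y : M.toSubmodule) :
      Tendsto (fun j => inner ℂ ((T ^ j) x) ((T ^ j) (y : H))) atTop (𝓝 0) := by
    refine squeeze_zero_norm (a := fun j => ‖x‖ * ‖(restrictTo T M hM ^ j) y‖) (fun j => ?_) ?_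
    · rw [Submodule.coe_norm, coe_restrictTo_pow]
      exact (norm_inner_le_norm _ _).trans
        (mul_le_mul_of_nonneg_right (norm_pow_apply_le hcontr j x) (norm_nonneg _))
    · simpa using (hCD.tendsto_pow (fun z => hcontr z) y).norm.const_mul ‖x‖
  have hdiff (x : H) (y : M.toSubmodule) (j : ℕ) :
      (fwdDiff 1)^[n] (fun i => inner ℂ ((T ^ i) x) ((T ^ i) (y : H))) j =
        (-1 : ℂ) ^ n * (inner ℂ e ((restrictTo T M hM ^ j) y) *
          inner ℂ ((T ^ j) x) (defect T n (e : H))) := by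
    rw [fwdDiff_iter_inner_pow, ← coe_restrictTo_pow T M hM j y,
      defect_apply_coe_eq_smul (hT n hn le_rfl) hM he hdefect, inner_smul_right]
  have horth (x : H) (hx : x ∈ M.toSubmoduleᗮ) (k : ℕ) :
      inner ℂ ((T ^ k) x) (defect T n (e : H)) = 0 := by
    obtain ⟨y, hy⟩ := exists_inner_pow_eq_single hsurj he hAe k
    obtain ⟨r, -, -, hr, hra⟩ := exists_pos_of_fwdDiff_iter_eq_single n k
      ((-1) ^ n * inner ℂ ((T ^ k) x) (defect T n (e : H))) _ (htend x y) fun j => by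
        rw [hdiff, hy]
        split_ifs with h <;> simp [h]
    have h := hra 0
    -- For `n ≥ 1` the factor at index 0 is positive even when `k > 0`.
    have hpos := hr 0 k.zero_le fun h => absurd h (by omega)
    simpa [M.toSubmodule.inner_left_of_mem_orthogonal y.2 hx, hpos.ne'] using h.symm
  refine ⟨M, ?_, hM_proper, hM, fun x hx => ?_⟩
  · intro hbot
    have hM0 : ∀ z ∈ M, z = 0 := by simp [hbot]
    have : e = 0 := Subtype.ext (hM0 e e.2)
    simp [this] at he
  · rw [Submodule.mem_orthogonal']
    intro y hy
    -- With `c = 0`, the whole sequence vanishes.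
    obtain ⟨r, -, -, -, hra⟩ := exists_pos_of_fwdDiff_iter_eq_single n 0 0 _
      (htend (T x) ⟨y, hy⟩) fun j => by
        rw [hdiff, ← mul_apply_eq_comp, ← pow_succ, horth x hx]
        simp
    simpa using hra 0
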